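/- Let $K$ be an algebraically closed field and $n\ge 2$. Let $K[x,y,z]$ be the polynomial ring in the $3n$ unknowns $x_i,y_i,z_i$ ($1\le i\le n$), with the $\mathbb{Z}^n$-grading $\deg x_i=\deg y_i=\deg z_i=e_i$, where $e_i$ is the $i$-th standard unit vector. Let $$M_n=\langle\, x_ix_j,\ x_iy_jy_k,\ y_iy_jy_ky_l \;:\; i,j,k,l\in\{1,\dots,n\}\text{ distinct}\,\rangle .$$ Let $\mathcal B\subset \mathrm{PGL}(3,K)$ be the subgroup of lower-triangular matrices modulo scaling, and let $(g_1,\dots,g_n)\in \mathrm{PGL}(3,K)^n$ act on $\mathbb{Z}^n$-homogeneous ideals of $K[x,y,z]$ through the substitution $(x_i,y_i,z_i)^T\mapsto g_i\,(x_i,y_i,z_i)^T$ for $i=1,\dots,n$. A $\mathbb{Z}^n$-homogeneous ideal $I\subseteq K[x,y,z]$ is called Borel-fixed if it is mapped to itself by every element of $\mathcal B^n$. **Proposition 3.6.** $M_n$ is the unique $\mathbb{Z}^n$-homogeneous ideal $I$ of $K[x,y,z]$ that is Borel-fixed and for which $K[x,y,z]/I$ has the multigraded Hilbert function $$\mathbb{N}^n\to\mathbb{N},\qquad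 (u_1,\dots,u_n)\mapsto \dim_K\bigl(K[x,y,z]/I\bigr)_{(u_1,\dots,u_n)}=\binom{u_1+\cdots+u_n+3}{3}-\sum_{i=1}^n\binom{u_i+2}{3}.$$ That is, $M_n$ has these properties, and every ideal with these properties equals $M_n$. -/

import Mathlib

open scoped MatrixGroups

namespace Multiview

/-- The polynomial ring `K[x, y, z]` in the `3n` unknowns `x_i, y_i, z_i`, `i ∈ Fin n`.
The index `(i, 0)` is `x_i`, `(i, 1)` is `y_i` and `(i, 2)` is `z_i`. -/
abbrev Poly (n : ℕ) (K : Type*) [Field K] : Type _ := MvPolynomial (Fin n × Fin 3) K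

section Ideals

/-- The unknown `x_i`. -/
noncomputable def x {n : ℕ} {K : Type*} [Field K] (i : Fin n) : Poly n K := MvPolynomial.X (i, 0)

/-- The unknown `y_i`. -/
noncomputable def y {n : ℕ} {K : Type*} [Field K] (i : Fin n) : Poly n K := MvPolynomial.X (i, 1)

/-- The generic initial ideal `M_n`, generated by the monomials `x_i x_j`, `x_i y_j y_k` and
`y_i y_j y_k y_l`, where `i, j, k, l` run over distinct indices. -/
noncomputable def genericInitialIdeal (n : ℕ) (K : Type*) [Field K] : Ideal (Poly n K) :=
  Ideal.span
    ({f | ∃ i j : Fin n, i ≠ j ∧ f = x i * x j} ∪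
     {f | ∃ i j k : Fin n, i ≠ j ∧ i ≠ k ∧ j ≠ k ∧ f = x i * y j * y k} ∪
     {f | ∃ i j k l : Fin n, i ≠ j ∧ i ≠ k ∧ i ≠ l ∧ j ≠ k ∧ j ≠ l ∧ k ≠ l ∧
        f = y i * y j * y k * y l})

end Ideals

section Grading

/-- The degrees `deg x_i = deg y_i = deg z_i = e_i` (the `i`-th unit vector). -/
def degVec (n : ℕ) (p : Fin n × Fin 3) : Fin n → ℕ := Pi.single p.1 1

variable {n : ℕ} {K : Type*} [Field K]

/-- The ideal `I` is homogeneous for the `ℤⁿ`-grading: it contains every homogeneous component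
of each of its elements. (All degrees of polynomials lie in `ℕⁿ`.) -/
def IsMultihomogeneous (I : Ideal (Poly n K)) : Prop :=
  ∀ f ∈ I, ∀ u : Fin n → ℕ, MvPolynomial.weightedHomogeneousComponent (degVec n) u f ∈ I

/-- The degree `u` part of `K[x, y, z] / I`: the image of the space of
polynomials of degree `u`. -/
noncomputable def quotientPart (I : Ideal (Poly n K)) (u : Fin n → ℕ) :
    Submodule K (Poly n K ⧸ I) :=
  (MvPolynomial.weightedHomogeneousSubmodule K (degVec n) u).map
    (Ideal.Quotient.mkₐ K I).toLinearMap

/-- The value at `u` of the multigraded Hilbert function of `K[x, y, z] / I`. -/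
noncomputable def hilbertFunction (I : Ideal (Poly n K)) (u : Fin n → ℕ) : ℕ :=
  Module.finrank K (quotientPart I u)

/-- `I` is a `ℤⁿ`-homogeneous ideal such that `K[x, y, z] / I` has the Hilbert function
`u ↦ C(u_1 + ⋯ + u_n + 3, 3) - ∑ i, C(u_i + 2, 3)`. -/
def HasMultiviewHilbertFunction (I : Ideal (Poly n K)) : Prop :=
  IsMultihomogeneous I ∧
    ∀ u : Fin n → ℕ, (hilbertFunction I u : ℤ) =
      (((∑ i, u i) + 3).choose 3 : ℤ) - ∑ i, ((u i + 2).choose 3 : ℤ)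

end Grading

section Borel

/-- The group of invertible lower triangular `3 × 3` matrices. -/
def lowerTriangular (K : Type*) [Field K] : Subgroup (GL (Fin 3) K) where
  carrier := {g | ∀ i j : Fin 3, i < j → (g : Matrix (Fin 3) (Fin 3) K) i j = 0}
  one_mem' := by
    intro i j hij
    simp [Matrix.one_apply_ne hij.ne]
  mul_mem' := by
    intro a b ha hb i j hij
    have ha' : (a : Matrix (Fin 3) (Fin 3) K).BlockTriangular OrderDual.toDual :=
      fun i j h => ha i j h
    have hb' : (b : Matrix (Fin 3) (Fin 3) K).BlockTriangular OrderDual.toDual :=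
      fun i j h => hb i j h
    exact (ha'.mul hb') hij
  inv_mem' := by
    intro a ha i j hij
    have ha' : (a : Matrix (Fin 3) (Fin 3) K).BlockTriangular OrderDual.toDual :=
      fun i j h => ha i j h
    have : Invertible (a : Matrix (Fin 3) (Fin 3) K) := a.invertible
    rw [Matrix.coe_units_inv]
    exact Matrix.blockTriangular_inv_of_blockTriangular ha' hij

/-- The Borel subgroup of `PGL(3, K)`: lower triangular matrices modulo scaling. -/
def borel (K : Type*) [Field K] : Subgroup (PGL(3, K)) :=
  (lowerTriangular K).map Matrix.ProjGenLinGroup.mk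

variable {n : ℕ} {K : Type*} [Field K]

/-- The substitution `(x_i, y_i, z_i)ᵀ ↦ g_i (x_i, y_i, z_i)ᵀ` for `g = (g_1, …, g_n)`. -/
noncomputable def substitution (g : Fin n → GL (Fin 3) K) : Poly n K →ₐ[K] Poly n K :=
  MvPolynomial.aeval fun p : Fin n × Fin 3 =>
    ∑ k : Fin 3, MvPolynomial.C ((g p.1 : Matrix (Fin 3) (Fin 3) K) p.2 k) *
      MvPolynomial.X (p.1, k)

/-- `I` is fixed by `Bⁿ`, where `B` is the Borel subgroup of `PGL(3, K)`: for every `b ∈ Bⁿ`, the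
substitution by any tuple of matrices `g` representing `b` carries `I` onto itself. The
substitution is an automorphism, so `I.map` is the image of `I`. Rescaling the `g_i` multiplies a
homogeneous polynomial by a nonzero constant, so the image of a homogeneous ideal does not depend
on the choice of `g`. -/
def IsBorelFixed (I : Ideal (Poly n K)) : Prop :=
  ∀ b : Fin n → PGL(3, K), (∀ i, b i ∈ borel K) →
    ∀ g : Fin n → GL (Fin 3) K, (∀ i, Matrix.ProjGenLinGroup.mk (g i) = b i) →
      I.map (substitution g) = I

end Borel

end Multiview

namespace Multiview

open Finset

/-! Over an infinite field, invariance under diagonal matrices makes a Borel-fixed ideal monomial,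
so the Hilbert function counts standard monomials, block by block.

For $M_n$, give each block level 2, 1 or 0 according to whether its earliest occurring variable is
$x$, is $y$, or is neither. A monomial is standard exactly when its levels add up to at most 3. A
block of degree $u$ has `u.multichoose k` monomials of level $k\le 2$. The Vandermonde identity over
all tuples of sum at most 3 gives $\binom{\sum u_i+3}{3}$, and the tuples with an entry 3, which is
not a level, account for the subtracted $\sum\binom{u_i+2}{3}$. Borel invariance of $M_n$ is checked
on generators.

For uniqueness, let $I$ contain a monomial $e$ outside $M_n$. The levels of $e$ are bounded by the
multiplicities in a triple $(a,b,c)$ of indices, not all equal. The third difference of the Hilbert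
function in directions $a,b,c$ is 1. Truncating exponents at a large $N$ splits the standard
monomials of $I$ into finitely many products of blocks, and a product survives the differences only
if every block $l$ has more unbounded variables than the multiplicity of $l$
(`exists_notMem_of_card_eq`). Some standard $t$ of $I$ therefore has, in every block, an unbounded
variable no later than the variables of $e$. Borel moves turn $e$ into a product of powers of these
variables (`IsBorelFixed.single_mem_exponents`), which divides $t$: a contradiction. So $I$ has no
monomials outside $M_n$, and equality of Hilbert functions gives $I=M_n$. -/

/-- The exponents, block by block, of the monomials of multidegree `u`. -/
def exponentsOfDegree {n : ℕ} (u : Fin n → ℕ) : Finset (Fin n → Fin 3 → ℕ) :=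
  Fintype.piFinset fun i => piAntidiag univ (u i)

lemma mem_exponentsOfDegree {n : ℕ} {u : Fin n → ℕ} {e : Fin n → Fin 3 → ℕ} :
    e ∈ exponentsOfDegree u ↔ ∀ i, ∑ v, e i v = u i := by
  simp [exponentsOfDegree]

/-- Counting the exponents of degree `u` by a block-wise classification `κ`. -/
lemma card_filter_exponentsOfDegree {n : ℕ} {ι : Type*} [DecidableEq ι] (κ : (Fin 3 → ℕ) → ι)
    (s : Finset ι) (hs : ∀ e, κ e ∈ s) (P : (Fin n → ι) → Prop) [DecidablePred P]
    (u : Fin n → ℕ) :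
    #{e ∈ exponentsOfDegree u | P fun i => κ (e i)} =
      ∑ T ∈ (Fintype.piFinset fun _ : Fin n => s) with P T,
        ∏ i, #{e ∈ piAntidiag (univ : Finset (Fin 3)) (u i) | κ e = T i} := by
  rw [card_eq_sum_card_fiberwise (f := fun e i => κ (e i))
    (t := {T ∈ (Fintype.piFinset fun _ : Fin n => s) | P T})]
  · refine sum_congr rfl fun T hT => ?_
    rw [← Fintype.card_piFinset]
    congr 1
    ext e
    simp only [mem_filter, mem_exponentsOfDegree, Fintype.mem_piFinset, mem_piAntidiag,
      funext_iff] at hT ⊢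
    constructor
    · rintro ⟨⟨h1, -⟩, h3⟩ i
      exact ⟨⟨h1 i, by simp⟩, h3 i⟩
    · intro h
      refine ⟨⟨fun i => (h i).1.1, ?_⟩, fun i => (h i).2⟩
      have : (fun i => κ (e i)) = T := funext fun i => (h i).2
      rw [this]
      exact hT.2
  · intro e he
    simp only [coe_filter, Set.mem_ofPred_eq, Fintype.mem_piFinset] at he ⊢
    exact ⟨fun i => hs _, he.2⟩

/-! ### Finite differences of the Hilbert function and of block counts -/

section Differences

/-- The forward difference of a function of several variables in the direction `i`. -/
def diffAt {n : ℕ} (i : Fin n) (F : (Fin n → ℕ) → ℤ) (u : Fin n → ℕ) : ℤ :=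
  F (u + Pi.single i 1) - F u

lemma diffAt_sub {n : ℕ} (i : Fin n) (F G : (Fin n → ℕ) → ℤ) :
    diffAt i (fun u => F u - G u) = fun u => diffAt i F u - diffAt i G u := by
  funext u; simp only [diffAt]; ring

lemma diffAt_sum {n : ℕ} {ι : Type*} (s : Finset ι) (i : Fin n) (F : ι → (Fin n → ℕ) → ℤ) :
    diffAt i (fun u => ∑ T ∈ s, F T u) = fun u => ∑ T ∈ s, diffAt i (F T) u := by
  funext u; simp only [diffAt, sum_sub_distrib]

lemma diffAt_comp_sum {n : ℕ} (i : Fin n) (G : ℕ → ℤ) :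
    diffAt i (fun u => G (∑ l, u l)) = fun u => fwdDiff 1 G (∑ l, u l) := by
  funext u; simp [diffAt, fwdDiff, sum_add_distrib]

lemma diffAt_comp_eval {n : ℕ} (i l : Fin n) (G : ℕ → ℤ) :
    diffAt i (fun u => G (u l)) = fun u => (if i = l then fwdDiff 1 G else fun _ => 0) (u l) := by
  funext u
  split_ifs with h
  · subst h; simp [diffAt, fwdDiff]
  · simp [diffAt, h]

/-- Only the factor at `i` depends on the `i`-th variable, so the difference acts on that factor
alone. The vector `k` records how often each factor has been differenced. -/
lemma diffAt_prod {n : ℕ} (i : Fin n) (k : Fin n → ℕ) (c : Fin n → ℕ → ℤ) :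
    diffAt i (fun u => ∏ l, ((fwdDiff 1)^[k l] (c l)) (u l)) =
      fun u => ∏ l, ((fwdDiff 1)^[(k + Pi.single i 1 : Fin n → ℕ) l] (c l)) (u l) := by
  funext u
  simp only [diffAt]
  rw [← mul_prod_erase univ _ (mem_univ i), ← mul_prod_erase univ _ (mem_univ i),
    ← mul_prod_erase univ _ (mem_univ i)]
  have h1 : ∏ l ∈ univ.erase i, ((fwdDiff 1)^[k l] (c l)) ((u + Pi.single i 1 : Fin n → ℕ) l) =
      ∏ l ∈ univ.erase i, ((fwdDiff 1)^[k l] (c l)) (u l) :=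
    prod_congr rfl fun l hl => by simp [ne_of_mem_erase hl]
  have h2 : ∏ l ∈ univ.erase i, ((fwdDiff 1)^[(k + Pi.single i 1 : Fin n → ℕ) l] (c l)) (u l) =
      ∏ l ∈ univ.erase i, ((fwdDiff 1)^[k l] (c l)) (u l) :=
    prod_congr rfl fun l hl => by simp [ne_of_mem_erase hl]
  rw [h1, h2, ← sub_mul]
  simp [Function.iterate_succ_apply', fwdDiff]

/-- The number of occurrences of each index in `(a, b, c)`. -/
def tripleCount {n : ℕ} (a b c : Fin n) : Fin n → ℕ :=
  Pi.single a 1 + Pi.single b 1 + Pi.single c 1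

lemma sum_tripleCount {n : ℕ} (a b c : Fin n) : ∑ l, tripleCount a b c l = 3 := by
  simp [tripleCount, sum_add_distrib]

lemma diffAt_diffAt_diffAt_prod {n : ℕ} (a b c : Fin n) (f : Fin n → ℕ → ℤ) :
    diffAt a (diffAt b (diffAt c fun u => ∏ l, f l (u l))) =
      fun u => ∏ l, ((fwdDiff 1)^[tripleCount a b c l] (f l)) (u l) := by
  have h := diffAt_prod c 0 f
  simp only [Pi.zero_apply, Function.iterate_zero, id_eq] at h
  rw [h, diffAt_prod, diffAt_prod]
  funext u
  refine prod_congr rfl fun l _ => ?_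
  have e : (0 + Pi.single c 1 + Pi.single b 1 + Pi.single a 1 : Fin n → ℕ) = tripleCount a b c := by
    rw [tripleCount]; abel
  rw [e]

/-- The prescribed Hilbert function. -/
def multiviewCount {n : ℕ} (u : Fin n → ℕ) : ℤ :=
  (((∑ i, u i) + 3).choose 3 : ℤ) - ∑ i, ((u i + 2).choose 3 : ℤ)

lemma fwdDiff_choose_add (d k : ℕ) :
    fwdDiff 1 (fun s : ℕ => ((s + d).choose (k + 1) : ℤ)) = fun s => ((s + d).choose k : ℤ) := by
  funext s
  rw [fwdDiff, show s + 1 + d = s + d + 1 by ring, Nat.choose_succ_succ]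
  push_cast
  ring

/-- Each term depending on a single $u_l$ dies because one of the three directions differs from $l$;
this is where the triple must not be constant. What remains is the third difference of
$\binom{s+3}{3}$ in $s=\sum u_l$. -/
lemma diffAt_multiviewCount {n : ℕ} {a b c : Fin n} (h : ¬ (a = b ∧ b = c)) (u : Fin n → ℕ) :
    diffAt a (diffAt b (diffAt c multiviewCount)) u = 1 := by
  have hsum : ∀ (G : ℕ → ℤ) (l : Fin n),
      diffAt a (diffAt b (diffAt c fun u => G (u l))) = fun _ => 0 := by
    intro G l
    rw [diffAt_comp_eval, diffAt_comp_eval, diffAt_comp_eval]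
    have h0 : fwdDiff 1 (fun _ : ℕ => (0 : ℤ)) = fun _ => 0 := by funext s; simp [fwdDiff]
    by_cases h1 : a = l <;> by_cases h2 : b = l <;> by_cases h3 : c = l <;> simp_all
  have htop : ∀ G : ℕ → ℤ, diffAt a (diffAt b (diffAt c fun u => G (∑ l, u l))) =
      fun u => fwdDiff 1 (fwdDiff 1 (fwdDiff 1 G)) (∑ l, u l) := by
    intro G
    rw [diffAt_comp_sum, diffAt_comp_sum, diffAt_comp_sum]
  have e : (multiviewCount : (Fin n → ℕ) → ℤ) = fun u =>
    (fun u => (fun s : ℕ => ((s + 3).choose (2 + 1) : ℤ)) (∑ l, u l)) u -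
      (fun u => ∑ i, (fun i u => (fun s : ℕ => ((s + 2).choose 3 : ℤ)) (u i)) i u) u := rfl
  rw [e, diffAt_sub, diffAt_sub, diffAt_sub, diffAt_sum, diffAt_sum, diffAt_sum]
  have ht := congrFun (htop fun s : ℕ => ((s + 3).choose (2 + 1) : ℤ)) u
  have hs := fun l => congrFun (hsum (fun s : ℕ => ((s + 2).choose 3 : ℤ)) l) u
  simp only at ht hs ⊢
  rw [ht]
  simp only [hs, sum_const_zero, sub_zero]
  rw [fwdDiff_choose_add 3 2, fwdDiff_choose_add 3 1, fwdDiff_choose_add 3 0]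
  simp

/-- The exponents of degree `s` in one block which equal `t` off `A` and are at least `t` on `A`. -/
def blockExponents (t : Fin 3 → ℕ) (A : Finset (Fin 3)) (s : ℕ) : Finset (Fin 3 → ℕ) :=
  {e ∈ piAntidiag univ s | (∀ v, t v ≤ e v) ∧ ∀ v ∉ A, e v = t v}

lemma mem_blockExponents {t : Fin 3 → ℕ} {A : Finset (Fin 3)} {s : ℕ} {e : Fin 3 → ℕ} :
    e ∈ blockExponents t A s ↔ ∑ v, e v = s ∧ (∀ v, t v ≤ e v) ∧ ∀ v ∉ A, e v = t v := by
  simp [blockExponents]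

/-- Either the exponent at `v` equals `t v`, so that `v` is not free, or it is larger and can be
lowered by one. -/
lemma card_blockExponents_insert (t : Fin 3 → ℕ) {A : Finset (Fin 3)} {v : Fin 3} (hv : v ∉ A)
    (s : ℕ) :
    #(blockExponents t (insert v A) (s + 1)) =
      #(blockExponents t (insert v A) s) + #(blockExponents t A (s + 1)) := by
  rw [← card_image_of_injective (blockExponents t (insert v A) s)
    (add_left_injective (Pi.single v 1)), ← card_union_of_disjoint]
  · congr 1
    ext e
    simp only [mem_union, mem_image, mem_blockExponents]
    constructor
    · rintro ⟨h1, h2, h3⟩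
      by_cases h : e v = t v
      · refine Or.inr ⟨h1, h2, fun w hw => ?_⟩
        by_cases hwv : w = v
        · rw [hwv, h]
        · exact h3 w (by simp [hwv, hw])
      · have hle : (Pi.single v 1 : Fin 3 → ℕ) ≤ e := by
          intro w
          by_cases hwv : w = v
          · subst hwv
            have := h2 w
            simp; omega
          · simp [hwv]
        refine Or.inl ⟨e - Pi.single v 1, ⟨?_, ?_, ?_⟩, tsub_add_cancel_of_le hle⟩
        · have : ∑ w, e w = ∑ w, (e - Pi.single v 1 : Fin 3 → ℕ) w + ∑ w, (Pi.single v 1 : Fin 3 → ℕ) w := by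
            rw [← sum_add_distrib]
            exact sum_congr rfl fun w _ => (tsub_add_cancel_of_le (hle w)).symm
          rw [h1] at this
          simpa using this.symm
        · intro w
          by_cases hwv : w = v
          · subst hwv
            have := h2 w
            simp; omega
          · simpa [hwv] using h2 w
        · intro w hw
          have hwv : w ≠ v := fun h => hw (by simp [h])
          simpa [hwv] using h3 w hw
    · rintro (⟨e, ⟨h1, h2, h3⟩, rfl⟩ | ⟨h1, h2, h3⟩)
      · refine ⟨by simp [sum_add_distrib, h1], fun w => (h2 w).trans (by simp), fun w hw => ?_⟩
        have hwv : w ≠ v := fun h => hw (by simp [h])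
        simpa [hwv] using h3 w hw
      · exact ⟨h1, h2, fun w hw => h3 w (by simp at hw; exact hw.2)⟩
  · rw [disjoint_left]
    simp only [mem_image, mem_blockExponents]
    rintro _ ⟨e, ⟨-, h2, -⟩, rfl⟩ ⟨-, -, h3⟩
    have := h3 v hv
    have := h2 v
    simp at *
    omega

lemma fwdDiff_iterate_congr (k : ℕ) {f g : ℕ → ℤ} {s : ℕ} (h : ∀ r, s ≤ r → f r = g r) :
    (fwdDiff 1)^[k] f s = (fwdDiff 1)^[k] g s := by
  induction k generalizing f g s with
  | zero => exact h s le_rfl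
  | succ k ih =>
    rw [Function.iterate_succ_apply, Function.iterate_succ_apply]
    exact ih fun r hr => by simp [fwdDiff, h r hr, h (r + 1) (by omega)]

/-- The counting function of `blockExponents` is eventually polynomial of degree below `#A`. -/
lemma fwdDiff_iterate_card_blockExponents (t : Fin 3 → ℕ) (k : ℕ) (A : Finset (Fin 3))
    (hA : #A ≤ k) (s : ℕ) (hs : ∑ v, t v < s) :
    (fwdDiff 1)^[k] (fun r => (#(blockExponents t A r) : ℤ)) s = 0 := by
  have hempty : ∀ r, ∑ v, t v < r → #(blockExponents t ∅ r) = 0 := by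
    intro r hr
    rw [card_eq_zero, eq_empty_iff_forall_notMem]
    intro e he
    rw [mem_blockExponents] at he
    have : e = t := funext fun v => he.2.2 v (by simp)
    rw [this] at he
    omega
  induction k generalizing A s with
  | zero =>
    have : A = ∅ := by simpa using hA
    subst this
    simp [hempty s hs]
  | succ k ih =>
    rw [Function.iterate_succ_apply]
    obtain rfl | ⟨v, hv⟩ := A.eq_empty_or_nonempty
    · rw [fwdDiff_iterate_congr (g := fun r => (#(blockExponents t ∅ r) : ℤ)) k]
      · exact ih ∅ (by simp) s hs
      · intro r hr
        simp [fwdDiff, hempty r (by omega), hempty (r + 1) (by omega)]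
    · rw [← insert_erase hv]
      -- One difference removes a free variable, at the cost of a shift of the argument by one.
      have hstep : fwdDiff 1 (fun r => (#(blockExponents t (insert v (A.erase v)) r) : ℤ)) =
          fun r => (#(blockExponents t (A.erase v) (r + 1)) : ℤ) := by
        funext r
        simp only [fwdDiff]
        rw [card_blockExponents_insert t (notMem_erase v A)]
        push_cast; ring
      rw [hstep]
      have hshift : ∀ (f : ℕ → ℤ) (r : ℕ),
          (fwdDiff 1)^[k] (fun r => f (r + 1)) r = (fwdDiff 1)^[k] f (r + 1) := by
        intro f
        clear * -
        induction k generalizing f with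
        | zero => simp
        | succ k ih =>
          intro r
          rw [Function.iterate_succ_apply, Function.iterate_succ_apply]
          exact ih (fwdDiff 1 f) r
      rw [hshift fun r => (#(blockExponents t (A.erase v) r) : ℤ)]
      exact ih _ (by rw [card_erase_of_mem hv]; omega) _ (by omega)

end Differences

/-! ### Truncation of exponents and the standard monomials detected by third differences -/

section Truncation

/-- Upper sets of exponents are determined by truncations at a large bound (Dickson's lemma). -/
lemma exists_truncation_bound {α : Type*} [Finite α] {S : Set (α → ℕ)} (hS : IsUpperSet S) :
    ∃ N₀ : ℕ, ∀ N, N₀ ≤ N → ∀ e, e ∈ S → (fun a => min (e a) N) ∈ S := by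
  have := Fintype.ofFinite α
  have hfin : {e | Minimal (· ∈ S) e}.Finite := by
    have h : {e | Minimal (· ∈ S) e}.IsPWO := Set.isPWO_of_wellQuasiOrderedLE _
    exact IsAntichain.finite_of_partiallyWellOrderedOn (setOfPred_minimal_antichain _) h
  -- This bound exceeds every entry of each of the finitely many minimal elements, so truncation
  -- keeps an element above the minimal one below it.
  refine ⟨∑ e ∈ hfin.toFinset, ∑ a, e a, fun N hN e he => ?_⟩
  obtain ⟨m, hme, hm⟩ := exists_minimal_le_of_wellFoundedLT (· ∈ S) e he
  refine hS (fun a => ?_) hm.prop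
  refine le_min (hme a) (le_trans ?_ hN)
  refine le_trans (single_le_sum (f := fun a => m a) (fun _ _ => Nat.zero_le _) (mem_univ a)) ?_
  exact single_le_sum (f := fun e : α → ℕ => ∑ a, e a) (fun _ _ => Nat.zero_le _)
    (hfin.mem_toFinset.2 hm)

lemma filter_truncation_eq_blockExponents {N : ℕ} {t : Fin 3 → ℕ} (ht : ∀ v, t v ≤ N) (s : ℕ) :
    {e ∈ piAntidiag (univ : Finset (Fin 3)) s | (fun v => min (e v) N) = t} =
      blockExponents t {v | t v = N} s := by
  ext e
  simp only [mem_filter, mem_piAntidiag, mem_blockExponents, funext_iff, mem_univ, implies_true,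
    and_true, true_and]
  refine and_congr_right fun _ => ?_
  rw [← forall_and]
  refine forall_congr' fun v => ?_
  have := ht v
  omega

/-- If an upper set `S` of exponents has `multiviewCount u` non-members in every degree `u`, then
for every triple of indices and every large bound `N` it misses a `t` with more coordinates equal
to `N` in each block than the multiplicity of that block in the triple. -/
lemma exists_notMem_of_card_eq {n : ℕ} {S : Set (Fin n → Fin 3 → ℕ)} [DecidablePred (· ∈ S)]
    {N : ℕ} (hN : ∀ e, e ∈ S ↔ (fun i v => min (e i v) N) ∈ S)
    (hcard : ∀ u, (#{e ∈ exponentsOfDegree u | e ∉ S} : ℤ) = multiviewCount u)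
    {a b c : Fin n} (h : ¬ (a = b ∧ b = c)) :
    ∃ t ∉ S, ∀ l, tripleCount a b c l < #{v | t l v = N} := by
  set s : Finset (Fin 3 → ℕ) := Fintype.piFinset fun _ => range (N + 1)
  have key : (multiviewCount : (Fin n → ℕ) → ℤ) = fun u =>
      ∑ T ∈ (Fintype.piFinset fun _ : Fin n => s) with T ∉ S,
        ∏ i, (#(blockExponents (T i) {v | T i v = N} (u i)) : ℤ) := by
    funext u
    rw [← hcard u]
    have h1 : #{e ∈ exponentsOfDegree u | e ∉ S} =
        #{e ∈ exponentsOfDegree u | (fun i v => min (e i v) N) ∉ S} := by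
      congr 1
      ext e
      simp only [mem_filter]
      rw [hN]
    rw [h1, card_filter_exponentsOfDegree (fun e v => min (e v) N) s
      (fun e => by simp [s]) (fun T => T ∉ S)]
    push_cast
    refine sum_congr rfl fun T hT => prod_congr rfl fun i _ => ?_
    rw [filter_truncation_eq_blockExponents]
    intro v
    simp only [mem_filter, Fintype.mem_piFinset, s, mem_range] at hT
    have := hT.1 i v
    omega
  -- The entries of a truncated block are at most `N`, so its degree is at most `3 * N`; from `3 * N
  -- + 1` on, the vanishing of block differences applies.
  have h1 := diffAt_multiviewCount h (fun _ => 3 * N + 1)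
  rw [key] at h1
  simp only [diffAt_sum] at h1
  obtain ⟨T, hT, hne⟩ := exists_ne_zero_of_sum_ne_zero (h1.trans_ne one_ne_zero)
  simp only [mem_filter, Fintype.mem_piFinset, s, mem_range] at hT
  refine ⟨T, hT.2, fun l => ?_⟩
  by_contra hl
  refine hne ?_
  rw [diffAt_diffAt_diffAt_prod a b c fun l r =>
    (#(blockExponents (T l) {v | T l v = N} r) : ℤ)]
  refine prod_eq_zero (mem_univ l)
    (fwdDiff_iterate_card_blockExponents _ _ _ (not_lt.1 hl) _ ?_)
  have := hT.1 l
  show _ < 3 * N + 1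
  rw [Fin.sum_univ_three]
  have h0 := this 0
  have h1 := this 1
  have h2 := this 2
  omega

end Truncation

/-! ### Standard monomials of $M_n$ in terms of levels -/

section StandardMonomials

/-- The exponents of the monomials in `M_n`: those divisible by a generator. -/
def genericExponents (n : ℕ) : Set (Fin n → Fin 3 → ℕ) :=
  {e | (∃ i j, i ≠ j ∧ 0 < e i 0 ∧ 0 < e j 0) ∨
    (∃ i j k, i ≠ j ∧ i ≠ k ∧ j ≠ k ∧ 0 < e i 0 ∧ 0 < e j 1 ∧ 0 < e k 1) ∨
    ∃ i j k l, i ≠ j ∧ i ≠ k ∧ i ≠ l ∧ j ≠ k ∧ j ≠ l ∧ k ≠ l ∧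
      0 < e i 1 ∧ 0 < e j 1 ∧ 0 < e k 1 ∧ 0 < e l 1}

/-- The level of a monomial in one block: `2` if `x` occurs, else `1` if `y` occurs, else `0`. -/
def level (e : Fin 3 → ℕ) : ℕ := if 0 < e 0 then 2 else if 0 < e 1 then 1 else 0

lemma level_mem_range (e : Fin 3 → ℕ) : level e ∈ range 3 := by
  unfold level; split_ifs <;> simp

lemma level_le_two (e : Fin 3 → ℕ) : level e ≤ 2 :=
  Nat.lt_succ_iff.1 (mem_range.1 (level_mem_range e))

lemma two_le_level {e : Fin 3 → ℕ} (h : 0 < e 0) : 2 ≤ level e := by simp [level, h]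

lemma one_le_level {e : Fin 3 → ℕ} (h : 0 < e 1) : 1 ≤ level e := by
  unfold level; split_ifs <;> omega

lemma level_le_one {e : Fin 3 → ℕ} (h : ¬ 0 < e 0) : level e ≤ 1 := by
  unfold level; split_ifs <;> omega

lemma level_eq_zero {e : Fin 3 → ℕ} (h : ¬ 0 < e 0) (h' : ¬ 0 < e 1) : level e = 0 := by
  simp [level, h, h']

lemma tripleCount_pos {n : ℕ} {a b c l : Fin n} (h : l = a ∨ l = b ∨ l = c) :
    1 ≤ tripleCount a b c l := by
  rcases h with rfl | rfl | rfl <;> simp [tripleCount] <;> omega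

lemma two_le_tripleCount {n : ℕ} (a b : Fin n) : 2 ≤ tripleCount a a b a := by
  simp [tripleCount]

/-- Every exponent outside `M_n` lives on one of the facets of its Stanley-Reisner complex. -/
lemma exists_tripleCount_of_notMem {n : ℕ} (hn : 2 ≤ n) {e : Fin n → Fin 3 → ℕ}
    (he : e ∉ genericExponents n) :
    ∃ a b c : Fin n, ¬ (a = b ∧ b = c) ∧ ∀ l, level (e l) ≤ tripleCount a b c l := by
  simp only [genericExponents, Set.mem_ofPred_eq, not_or] at he
  obtain ⟨h1, h2, h3⟩ := he
  have hother : ∀ i : Fin n, ∃ j, j ≠ i := by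
    have : Nontrivial (Fin n) := Fin.nontrivial_iff_two_le.2 hn
    exact exists_ne
  by_cases hx : ∃ i, 0 < e i 0
  · obtain ⟨i, hi⟩ := hx
    have hx' : ∀ l, l ≠ i → ¬ 0 < e l 0 := fun l hl h => h1 ⟨i, l, hl.symm, hi, h⟩
    obtain ⟨j, hji, hj⟩ : ∃ j, j ≠ i ∧ ∀ l, l ≠ i → l ≠ j → ¬ 0 < e l 1 := by
      by_cases hy : ∃ j, j ≠ i ∧ 0 < e j 1
      · obtain ⟨j, hji, hj⟩ := hy
        exact ⟨j, hji, fun l hli hlj h => h2 ⟨i, j, l, hji.symm, hli.symm, hlj.symm, hi, hj, h⟩⟩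
      · obtain ⟨j, hj⟩ := hother i
        exact ⟨j, hj, fun l hl _ h => hy ⟨l, hl, h⟩⟩
    -- The block containing an $x$ is used twice; at most one other block contains a $y$.
    refine ⟨i, i, j, fun h => hji h.2.symm, fun l => ?_⟩
    by_cases hli : l = i
    · subst hli
      exact (level_le_two _).trans (two_le_tripleCount _ _)
    · by_cases hlj : l = j
      · exact (level_le_one (hx' l hli)).trans (tripleCount_pos (by simp [hlj]))
      · rw [level_eq_zero (hx' l hli) (hj l hli hlj)]
        exact Nat.zero_le _
  · have hx' : ∀ l, ¬ 0 < e l 0 := fun l h => hx ⟨l, h⟩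
    have hcover : ∀ a b c : Fin n, (∀ l, 0 < e l 1 → l = a ∨ l = b ∨ l = c) →
        ∀ l, level (e l) ≤ tripleCount a b c l := by
      intro a b c h l
      by_cases hl : 0 < e l 1
      · exact (level_le_one (hx' l)).trans (tripleCount_pos (h l hl))
      · rw [level_eq_zero (hx' l) hl]
        exact Nat.zero_le _
    -- With no $x$ present, the triple must cover the at most three blocks containing a $y$. When
    -- there are fewer than three, a repeated index, distinct from the last one, fills the triple
    -- without making it constant.
    by_cases hi : ∃ i, 0 < e i 1
    swap
    · obtain ⟨j, hj⟩ := hother ⟨0, by omega⟩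
      exact ⟨j, j, ⟨0, by omega⟩, fun h => hj h.2, hcover _ _ _ fun l hl => (hi ⟨l, hl⟩).elim⟩
    obtain ⟨i, hi⟩ := hi
    by_cases hj : ∃ j, j ≠ i ∧ 0 < e j 1
    swap
    · obtain ⟨j, hji⟩ := hother i
      exact ⟨j, j, i, fun h => hji h.2, hcover _ _ _ fun l hl => by
        by_contra hl'
        exact hj ⟨l, by tauto, hl⟩⟩
    obtain ⟨j, hji, hj⟩ := hj
    by_cases hk : ∃ k, k ≠ i ∧ k ≠ j ∧ 0 < e k 1
    swap
    · exact ⟨j, j, i, fun h => hji h.2, hcover _ _ _ fun l hl => by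
        by_contra hl'
        exact hk ⟨l, by tauto, by tauto, hl⟩⟩
    obtain ⟨k, hki, hkj, hk⟩ := hk
    refine ⟨i, j, k, fun h => hji h.1.symm, hcover _ _ _ fun l hl => ?_⟩
    by_contra hl'
    simp only [not_or] at hl'
    exact h3 ⟨i, j, k, l, hji.symm, hki.symm, Ne.symm hl'.1, hkj.symm, Ne.symm hl'.2.1,
      Ne.symm hl'.2.2, hi, hj, hk, hl⟩

/-- Every generator has weight 4 when $x$ counts 2 and $y$ counts 1, and its variables lie in
distinct blocks. -/
lemma four_le_sum_level {n : ℕ} {e : Fin n → Fin 3 → ℕ} (he : e ∈ genericExponents n) :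
    4 ≤ ∑ i, level (e i) := by
  have hsub : ∀ s : Finset (Fin n), ∑ i ∈ s, level (e i) ≤ ∑ i, level (e i) := fun s =>
    sum_le_sum_of_subset (subset_univ s)
  rcases he with ⟨i, j, hij, hi, hj⟩ | ⟨i, j, k, hij, hik, hjk, hi, hj, hk⟩ |
    ⟨i, j, k, l, hij, hik, hil, hjk, hjl, hkl, hi, hj, hk, hl⟩
  · have := hsub {i, j}
    rw [sum_pair hij] at this
    have := two_le_level hi
    have := two_le_level hj
    omega
  · have := hsub {i, j, k}
    rw [sum_insert (by simp [*]), sum_pair hjk] at this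
    have := two_le_level hi
    have := one_le_level hj
    have := one_le_level hk
    omega
  · have := hsub {i, j, k, l}
    rw [sum_insert (by simp [*]), sum_insert (by simp [*]), sum_pair hkl] at this
    have := one_le_level hi
    have := one_le_level hj
    have := one_le_level hk
    have := one_le_level hl
    omega

lemma notMem_genericExponents_iff {n : ℕ} (hn : 2 ≤ n) (e : Fin n → Fin 3 → ℕ) :
    e ∉ genericExponents n ↔ ∑ i, level (e i) ≤ 3 := by
  constructor
  · intro he
    obtain ⟨a, b, c, -, h⟩ := exists_tripleCount_of_notMem hn he
    exact (sum_le_sum fun l _ => h l).trans (sum_tripleCount a b c).le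
  · intro h he
    have := four_le_sum_level he
    omega

end StandardMonomials

/-! ### The number of standard monomials of $M_n$ -/

section Counting

lemma card_blockExponents_of_lt (t : Fin 3 → ℕ) (A : Finset (Fin 3)) {s : ℕ}
    (hs : s < ∑ v, t v) : #(blockExponents t A s) = 0 := by
  rw [card_eq_zero, eq_empty_iff_forall_notMem]
  intro e he
  rw [mem_blockExponents] at he
  have : ∑ v, t v ≤ ∑ v, e v := sum_le_sum fun v _ => he.2.1 v
  omega

lemma blockExponents_sum_self (t : Fin 3 → ℕ) (A : Finset (Fin 3)) :
    blockExponents t A (∑ v, t v) = {t} := by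
  ext e
  rw [mem_blockExponents, mem_singleton]
  constructor
  · rintro ⟨h1, h2, -⟩
    have := (sum_eq_sum_iff_of_le fun v _ => h2 v).1 h1.symm
    exact funext fun v => (this v (mem_univ v)).symm
  · rintro rfl
    simp

/-- The excess `r` over `t` is distributed freely among the variables in `A`. -/
lemma card_blockExponents (t : Fin 3 → ℕ) (A : Finset (Fin 3)) (r : ℕ) :
    #(blockExponents t A (∑ v, t v + r)) = (#A).multichoose r := by
  induction A using Finset.induction_on generalizing r with
  | empty =>
    cases r with
    | zero => simp [blockExponents_sum_self]
    | succ r =>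
      rw [card_empty, Nat.multichoose_zero_succ, card_eq_zero, eq_empty_iff_forall_notMem]
      intro e he
      rw [mem_blockExponents] at he
      have : e = t := funext fun v => he.2.2 v (by simp)
      rw [this] at he
      omega
  | insert v A hv ih =>
    rw [card_insert_of_notMem hv]
    induction r with
    | zero => simp [blockExponents_sum_self]
    | succ r ihr =>
      rw [← add_assoc, card_blockExponents_insert t hv, add_assoc _ r 1, ih, ihr,
        Nat.multichoose_succ_succ, add_comm]

/-- Each level set is a single block set: level 0 has only $z$ free, level 1 has $y\ge 1$ with $y,z$
free, level 2 has $x\ge 1$ with all three free. -/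
lemma card_filter_level (u k : ℕ) (hk : k ∈ range 3) :
    #{e ∈ piAntidiag (univ : Finset (Fin 3)) u | level e = k} = u.multichoose k := by
  have key : ∀ (t : Fin 3 → ℕ) (A : Finset (Fin 3)),
      (∀ e, level e = k ↔ (∀ v, t v ≤ e v) ∧ ∀ v ∉ A, e v = t v) →
      {e ∈ piAntidiag (univ : Finset (Fin 3)) u | level e = k} = blockExponents t A u := by
    intro t A h
    ext e
    simp [mem_blockExponents, h]
  have hk' : k = 0 ∨ k = 1 ∨ k = 2 := by rw [mem_range] at hk; omega
  rcases hk' with rfl | rfl | rfl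
  · rw [key 0 {2}]
    · simpa using card_blockExponents 0 {2} u
    · intro e
      simp only [level, Fin.forall_fin_succ]
      simp
      grind
  · rw [key ![0, 1, 0] {1, 2}]
    · cases u with
      | zero => rw [card_blockExponents_of_lt _ _ (by simp [Fin.sum_univ_three])]; simp
      | succ u =>
        have := card_blockExponents ![0, 1, 0] {1, 2} u
        simp only [Fin.sum_univ_three] at this
        simp at this
        rw [add_comm u, this]
        simp
        omega
    · intro e
      simp only [level, Fin.forall_fin_succ]
      simp
      grind
  · rw [key ![1, 0, 0] univ]
    · cases u with
      | zero => rw [card_blockExponents_of_lt _ _ (by simp [Fin.sum_univ_three])]; simp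
      | succ u =>
        have := card_blockExponents ![1, 0, 0] univ u
        simp only [Fin.sum_univ_three] at this
        simp at this
        rw [add_comm u, this, Nat.multichoose_eq, Nat.multichoose_eq]
        have h := Nat.choose_symm_add (a := u) (b := 2)
        rw [show 3 + u - 1 = u + 2 by omega, show 1 + u + 2 - 1 = u + 2 by omega, h]
    · intro e
      simp only [level, Fin.forall_fin_succ]
      simp
      grind

/-- The generating function is $(1-X)^{-u}$; its multiplicativity in $u$ yields the Vandermonde
identity. -/
lemma mk_multichoose_eq_pow (u : ℕ) :
    PowerSeries.mk (fun k => (u.multichoose k : ℤ)) = (PowerSeries.mk 1) ^ u := by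
  cases u with
  | zero =>
    ext k
    cases k <;> simp [PowerSeries.coeff_one]
  | succ u =>
    rw [PowerSeries.mk_one_pow_eq_mk_choose_add]
    ext k
    simp only [PowerSeries.coeff_mk, Nat.multichoose_eq]
    rw [show u + 1 + k - 1 = u + k by omega, Nat.choose_symm_add]

/-- The Vandermonde identity for multiset coefficients. -/
lemma sum_piAntidiag_prod_multichoose {n : ℕ} (u : Fin n → ℕ) (d : ℕ) :
    ∑ τ ∈ piAntidiag univ d, ∏ i, (u i).multichoose (τ i) = (∑ i, u i).multichoose d := by
  have h : ∏ i, PowerSeries.mk (fun k => ((u i).multichoose k : ℤ)) =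
      PowerSeries.mk fun k => ((∑ i, u i).multichoose k : ℤ) := by
    simp_rw [mk_multichoose_eq_pow, prod_pow_eq_pow_sum]
  have h' := congrArg (PowerSeries.coeff d) h
  rw [PowerSeries.coeff_prod] at h'
  simp only [PowerSeries.coeff_mk] at h'
  zify
  rw [← h']
  refine sum_bij' (fun τ _ => Finsupp.equivFunOnFinite.symm τ) (fun τ _ => ⇑τ) ?_ ?_ ?_ ?_ ?_
  all_goals simp

lemma sum_prod_multichoose_of_sum_le {n : ℕ} (u : Fin n → ℕ) :
    ∑ τ ∈ (Fintype.piFinset fun _ : Fin n => range 4) with ∑ i, τ i ≤ 3,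
      ∏ i, (u i).multichoose (τ i) = (∑ i, u i + 3).choose 3 := by
  have h : (Fintype.piFinset fun _ : Fin n => range 4).filter (fun τ => ∑ i, τ i ≤ 3) =
      (range 4).biUnion fun d => piAntidiag univ d := by
    ext τ
    simp only [mem_filter, Fintype.mem_piFinset, mem_range, mem_biUnion, mem_piAntidiag, mem_univ,
      implies_true, and_true]
    constructor
    · rintro ⟨-, h⟩
      exact ⟨_, Nat.lt_succ_iff.2 h, rfl⟩
    · rintro ⟨d, hd, rfl⟩
      have hd' : ∑ i, τ i ≤ 3 := Nat.lt_succ_iff.1 hd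
      refine ⟨fun i => ?_, hd'⟩
      have := single_le_sum (f := τ) (fun _ _ => Nat.zero_le _) (mem_univ i)
      omega
  rw [h, sum_biUnion]
  · simp_rw [sum_piAntidiag_prod_multichoose]
    rw [Nat.sum_range_multichoose 3, add_comm 3, Nat.choose_symm_add]
  · intro d _ d' _ hdd'
    rw [Function.onFun, disjoint_left]
    intro τ h1 h2
    rw [mem_piAntidiag] at h1 h2
    exact hdd' (h1.1.symm.trans h2.1)

lemma sum_prod_multichoose_range_three {n : ℕ} (u : Fin n → ℕ) :
    ∑ τ ∈ (Fintype.piFinset fun _ : Fin n => range 3) with ∑ i, τ i ≤ 3,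
      ∏ i, (u i).multichoose (τ i) + ∑ i, (u i + 2).choose 3 = (∑ i, u i + 3).choose 3 := by
  rw [← sum_prod_multichoose_of_sum_le]
  have hinj : Function.Injective fun i : Fin n => (Pi.single i 3 : Fin n → ℕ) := by
    intro i j hij
    by_contra hne
    have := congrFun hij i
    simp [hne] at this
  -- A tuple of sum at most 3 having an entry 3 is three times a unit vector. These are exactly the
  -- tuples lost when entries are restricted to the levels 0, 1, 2.
  have h1 : ∑ i, (u i + 2).choose 3 =
      ∑ τ ∈ univ.image fun i : Fin n => (Pi.single i 3 : Fin n → ℕ),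
        ∏ i, (u i).multichoose (τ i) := by
    rw [sum_image fun i _ j _ h => hinj h]
    refine sum_congr rfl fun i _ => ?_
    rw [prod_eq_single i]
    · simp [Nat.multichoose_eq]
    · intro j _ hj
      simp [hj]
    · simp
  rw [h1, ← sum_union]
  · refine sum_congr ?_ fun _ _ => rfl
    ext τ
    simp only [mem_union, mem_filter, Fintype.mem_piFinset, mem_range, mem_image, mem_univ,
      true_and]
    constructor
    · rintro (⟨h, h'⟩ | ⟨i, rfl⟩)
      · exact ⟨fun i => (h i).trans (by norm_num), h'⟩
      · refine ⟨fun j => ?_, by simp⟩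
        by_cases hj : j = i
        · subst hj; simp
        · simp [hj]
    · rintro ⟨h, h'⟩
      by_cases h3 : ∃ i, τ i = 3
      · obtain ⟨i, hi⟩ := h3
        refine Or.inr ⟨i, ?_⟩
        rw [← add_sum_erase _ _ (mem_univ i)] at h'
        have h0 : ∑ j ∈ univ.erase i, τ j = 0 := by omega
        rw [sum_eq_zero_iff] at h0
        funext j
        by_cases hj : j = i
        · subst hj; simp [hi]
        · simp [hj, h0 j (by simp [hj])]
      · refine Or.inl ⟨fun i => ?_, h'⟩
        have := h i
        have : τ i ≠ 3 := fun h => h3 ⟨i, h⟩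
        omega
  · rw [disjoint_left]
    intro τ h1 h2
    simp only [mem_filter, Fintype.mem_piFinset, mem_range, mem_image, mem_univ,
      true_and] at h1 h2
    obtain ⟨i, rfl⟩ := h2
    have := h1.1 i
    simp at this

open Classical in
lemma card_notMem_genericExponents {n : ℕ} (hn : 2 ≤ n) (u : Fin n → ℕ) :
    (#{e ∈ exponentsOfDegree u | e ∉ genericExponents n} : ℤ) = multiviewCount u := by
  simp_rw [notMem_genericExponents_iff hn]
  rw [card_filter_exponentsOfDegree level (range 3) level_mem_range (fun τ => ∑ i, τ i ≤ 3)]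
  rw [multiviewCount, eq_sub_iff_add_eq]
  norm_cast
  rw [← sum_prod_multichoose_range_three]
  congr 1
  refine sum_congr rfl fun τ hτ => prod_congr rfl fun i _ => card_filter_level _ _ ?_
  simp only [mem_filter, Fintype.mem_piFinset] at hτ
  exact hτ.1 i

end Counting

open MvPolynomial

variable {n : ℕ} {K : Type*} [Field K]

/-! ### Monomial ideals and their Hilbert functions -/

section MonomialIdeals

/-- Exponents sorted by blocks, as exponents of `MvPolynomial`. -/
noncomputable def exponentEquiv (n : ℕ) : (Fin n → Fin 3 → ℕ) ≃ (Fin n × Fin 3 →₀ ℕ) :=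
  (Equiv.curry _ _ _).symm.trans Finsupp.equivFunOnFinite.symm

@[simp]
lemma exponentEquiv_symm_apply (d : Fin n × Fin 3 →₀ ℕ) (i : Fin n) (v : Fin 3) :
    (exponentEquiv n).symm d i v = d (i, v) := rfl

/-- The monomial with exponents `e`. -/
noncomputable def monomialOf (K : Type*) [Field K] (e : Fin n → Fin 3 → ℕ) : Poly n K :=
  monomial (exponentEquiv n e) 1

lemma monomialOf_eq_prod (e : Fin n → Fin 3 → ℕ) :
    monomialOf K e = ∏ i, ∏ v, X (i, v) ^ e i v := by
  rw [monomialOf, monomial_eq, C_1, one_mul, Finsupp.prod_fintype _ _ fun _ => pow_zero _,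
    Fintype.prod_prod_type]
  rfl

/-- The exponents of the monomials in an ideal. -/
def exponents (I : Ideal (Poly n K)) : Set (Fin n → Fin 3 → ℕ) := {e | monomialOf K e ∈ I}

lemma isUpperSet_exponents (I : Ideal (Poly n K)) : IsUpperSet (exponents I) := by
  intro e e' h he
  have hdvd : monomialOf K e ∣ monomialOf K e' := by
    rw [monomialOf, monomialOf, monomial_dvd_monomial]
    exact ⟨Or.inr fun p => h p.1 p.2, one_dvd _⟩
  exact I.mem_of_dvd hdvd he

/-- A monomial ideal: it contains the monomials of its elements. -/
def IsMonomialIdeal (I : Ideal (Poly n K)) : Prop :=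
  ∀ f ∈ I, ∀ d, f.coeff d ≠ 0 → monomial d 1 ∈ I

lemma monomial_mem_of_one {I : Ideal (Poly n K)} {d : Fin n × Fin 3 →₀ ℕ}
    (h : monomial d 1 ∈ I) (c : K) : monomial d c ∈ I := by
  rw [← mul_one c, ← C_mul_monomial]
  exact I.mul_mem_left _ h

lemma IsMonomialIdeal.mem_iff {I : Ideal (Poly n K)} (hI : IsMonomialIdeal I) {f : Poly n K} :
    f ∈ I ↔ ∀ d, f.coeff d ≠ 0 → monomial d 1 ∈ I := by
  refine ⟨hI f, fun h => ?_⟩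
  rw [f.as_sum]
  exact I.sum_mem fun d hd => monomial_mem_of_one (h d (mem_support_iff.1 hd)) _

lemma mem_exponents_symm {I : Ideal (Poly n K)} {d : Fin n × Fin 3 →₀ ℕ} :
    (exponentEquiv n).symm d ∈ exponents I ↔ monomial d 1 ∈ I := by
  rw [exponents, Set.mem_ofPred_eq, monomialOf, Equiv.apply_symm_apply]

lemma IsMonomialIdeal.ext {I J : Ideal (Poly n K)} (hI : IsMonomialIdeal I)
    (hJ : IsMonomialIdeal J) (h : exponents I = exponents J) : I = J := by
  refine Ideal.ext fun f => ?_
  rw [hI.mem_iff, hJ.mem_iff]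
  simp_rw [← mem_exponents_symm, h]

lemma IsMonomialIdeal.isMultihomogeneous {I : Ideal (Poly n K)} (hI : IsMonomialIdeal I) :
    IsMultihomogeneous I := by
  intro f hf u
  rw [hI.mem_iff]
  intro d hd
  classical
  rw [coeff_weightedHomogeneousComponent] at hd
  exact hI f hf d fun h => hd (by simp [h])

lemma weight_degVec (d : Fin n × Fin 3 →₀ ℕ) (i : Fin n) :
    Finsupp.weight (degVec n) d i = ∑ v, d (i, v) := by
  rw [Finsupp.weight_apply, Finsupp.sum_fintype _ _ (by simp), Finset.sum_apply,
    Fintype.sum_prod_type, sum_eq_single i]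
  · simp [degVec]
  · intro j _ hj
    simp [degVec, hj.symm]
  · simp

open Classical in
/-- The Hilbert function of a monomial ideal counts standard monomials. -/
lemma IsMonomialIdeal.hilbertFunction_eq {I : Ideal (Poly n K)} (hI : IsMonomialIdeal I)
    (u : Fin n → ℕ) :
    hilbertFunction I u = #{e ∈ exponentsOfDegree u | e ∉ exponents I} := by
  set s : Finset (Fin n → Fin 3 → ℕ) := {e ∈ exponentsOfDegree u | e ∉ exponents I} with hs
  have hmem : ∀ e, e ∈ s ↔ (∀ i, ∑ v, e i v = u i) ∧ e ∉ exponents I := by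
    intro e; rw [hs, mem_filter, mem_exponentsOfDegree]
  let b : s → Poly n K ⧸ I := fun e => Ideal.Quotient.mkₐ K I (monomialOf K e.1)
  have hb : LinearIndependent K b := by
    rw [Fintype.linearIndependent_iff]
    intro c hc e
    have h1 : ∑ e : s, monomial (exponentEquiv n e.1) (c e) ∈ I := by
      rw [← Ideal.Quotient.eq_zero_iff_mem, ← Ideal.Quotient.mkₐ_eq_mk K, map_sum, ← hc]
      refine sum_congr rfl fun e' _ => ?_
      rw [← map_smul, monomialOf, smul_monomial, smul_eq_mul, mul_one]
    by_contra hne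
    refine ((hmem e.1).1 e.2).2 (hI _ h1 (exponentEquiv n e.1) ?_)
    rw [coeff_sum, sum_eq_single e]
    · simpa using hne
    · intro e' _ he'
      rw [coeff_monomial, if_neg]
      intro h
      exact he' (Subtype.ext ((exponentEquiv n).injective h))
    · simp
  have hspan : quotientPart I u = Submodule.span K (Set.range b) := by
    apply le_antisymm
    · rw [quotientPart, Submodule.map_le_iff_le_comap]
      intro f hf
      rw [Submodule.mem_comap, f.as_sum, map_sum]
      refine Submodule.sum_mem _ fun d hd => ?_
      by_cases hd' : (exponentEquiv n).symm d ∈ exponents I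
      · rw [mem_exponents_symm] at hd'
        have : (Ideal.Quotient.mkₐ K I).toLinearMap (monomial d (coeff d f)) = 0 :=
          Ideal.Quotient.eq_zero_iff_mem.2 (monomial_mem_of_one hd' _)
        rw [this]
        exact Submodule.zero_mem _
      · have hds : (exponentEquiv n).symm d ∈ s := by
          rw [hmem]
          refine ⟨fun i => ?_, hd'⟩
          have := (mem_weightedHomogeneousSubmodule K (degVec n) u f).1 hf (mem_support_iff.1 hd)
          rw [← this, weight_degVec]
          rfl
        have : monomial d (coeff d f) = coeff d f • monomialOf K ((exponentEquiv n).symm d) := by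
          rw [monomialOf, smul_monomial, Equiv.apply_symm_apply, smul_eq_mul, mul_one]
        rw [this, map_smul]
        exact Submodule.smul_mem _ _ (Submodule.subset_span ⟨⟨_, hds⟩, rfl⟩)
    · rw [Submodule.span_le]
      rintro _ ⟨e, rfl⟩
      refine Submodule.mem_map_of_mem (f := (Ideal.Quotient.mkₐ K I).toLinearMap) ?_
      rw [mem_weightedHomogeneousSubmodule]
      refine isWeightedHomogeneous_monomial _ _ _ (funext fun i => ?_)
      rw [weight_degVec]
      exact ((hmem e.1).1 e.2).1 i
  rw [hilbertFunction, hspan, finrank_span_eq_card hb, Fintype.card_coe]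

end MonomialIdeals

/-! ### Consequences of Borel invariance: torus action and shears -/

section Borel

lemma IsBorelFixed.substitution_mem {I : Ideal (Poly n K)} (hI : IsBorelFixed I)
    {g : Fin n → GL (Fin 3) K} (hg : ∀ i, g i ∈ lowerTriangular K) {f : Poly n K} (hf : f ∈ I) :
    substitution g f ∈ I := by
  have h := hI (fun i => Matrix.ProjGenLinGroup.mk (g i))
    (fun i => Subgroup.mem_map_of_mem _ (hg i)) g fun _ => rfl
  rw [← h]
  exact Ideal.mem_map_of_mem _ hf

/-- A tuple of invertible diagonal matrices. -/
noncomputable def torusElement (t : Fin n × Fin 3 → K) (ht : ∀ p, t p ≠ 0) (i : Fin n) :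
    GL (Fin 3) K :=
  Matrix.GeneralLinearGroup.mkOfDetNeZero (Matrix.diagonal fun v => t (i, v)) (by
    rw [Matrix.det_diagonal]
    exact prod_ne_zero_iff.2 fun v _ => ht _)

lemma coe_torusElement (t : Fin n × Fin 3 → K) (ht : ∀ p, t p ≠ 0) (i : Fin n) :
    (torusElement t ht i : Matrix (Fin 3) (Fin 3) K) = Matrix.diagonal fun v => t (i, v) := rfl

lemma torusElement_mem (t : Fin n × Fin 3 → K) (ht : ∀ p, t p ≠ 0) (i : Fin n) :
    torusElement t ht i ∈ lowerTriangular K := by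
  intro v w hvw
  rw [coe_torusElement, Matrix.diagonal_apply_ne _ hvw.ne]

lemma substitution_X (g : Fin n → GL (Fin 3) K) (p : Fin n × Fin 3) :
    substitution g (X p) =
      ∑ k : Fin 3, C ((g p.1 : Matrix (Fin 3) (Fin 3) K) p.2 k) * X (p.1, k) := by
  rw [substitution, aeval_X]

lemma substitution_torusElement_monomial (t : Fin n × Fin 3 → K) (ht : ∀ p, t p ≠ 0)
    (d : Fin n × Fin 3 →₀ ℕ) (c : K) :
    substitution (torusElement t ht) (monomial d c) =
      (c * d.prod fun p k => t p ^ k) • monomial d 1 := by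
  have hX : ∀ p, substitution (torusElement t ht) (X p) = C (t p) * X p := by
    intro p
    rw [substitution_X, sum_eq_single p.2]
    · simp [coe_torusElement]
    · intro k _ hk
      simp [coe_torusElement, hk.symm]
    · simp
  rw [monomial_eq, map_mul, Finsupp.prod, map_prod]
  simp_rw [map_pow, hX, mul_pow, prod_mul_distrib]
  rw [monomial_eq, ← algebraMap_eq, AlgHom.commutes, algebraMap_eq, smul_eq_C_mul, C_mul, C_1,
    Finsupp.prod, Finsupp.prod, map_prod]
  simp_rw [map_pow]
  ring

/-- Over an infinite field, invariance under the torus makes an ideal monomial. -/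
lemma IsBorelFixed.isMonomialIdeal [Infinite K] {I : Ideal (Poly n K)} (hI : IsBorelFixed I) :
    IsMonomialIdeal I := by
  intro f hf d hd
  by_contra hne
  -- A linear functional `φ` vanishes on `I` but not on the monomial `d`. Applied to the torus orbit
  -- of `f`, it is a polynomial `P` in the torus parameters that vanishes wherever all of them are
  -- nonzero. Hence `P = 0`, although its coefficient at `d` is nonzero.
  obtain ⟨φ, hφ, hle⟩ := Submodule.exists_le_ker_of_notMem (p := I.restrictScalars K) hne
  let P : MvPolynomial (Fin n × Fin 3) K :=
    ∑ e ∈ f.support, monomial e (coeff e f * φ (monomial e 1))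
  have hP : P = 0 := by
    refine funext_set (fun _ => {0}ᶜ) (fun _ => (Set.finite_singleton 0).infinite_compl) ?_
    intro t ht
    have ht' : ∀ p, t p ≠ 0 := fun p => by simpa using ht p (Set.mem_univ _)
    have h0 : φ (substitution (torusElement t ht') f) = 0 :=
      hle (hI.substitution_mem (torusElement_mem t ht') hf)
    rw [f.as_sum, map_sum, map_sum] at h0
    rw [map_zero, ← h0, map_sum]
    refine sum_congr rfl fun e _ => ?_
    rw [substitution_torusElement_monomial, map_smul, eval_monomial, smul_eq_mul]
    ring
  have hc := congrArg (coeff d) hP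
  simp only [P, coeff_sum, coeff_monomial, coeff_zero, sum_ite_eq'] at hc
  rw [if_pos (mem_support_iff.2 hd)] at hc
  exact mul_ne_zero hd hφ hc

/-- The matrices adding the `v i`-th variable of each block to all later variables. -/
noncomputable def shearElement (K : Type*) [Field K] (v : Fin n → Fin 3) (i : Fin n) :
    GL (Fin 3) K :=
  Matrix.GeneralLinearGroup.mkOfDetNeZero
    (Matrix.of fun w k => if w = k ∨ (k = v i ∧ k < w) then 1 else 0) (by
      rw [Matrix.det_of_isLowerTriangular]
      · simp
      · intro w k hwk
        have hwk' : w < k := hwk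
        simp [hwk'.ne, hwk'.le])

lemma coe_shearElement (v : Fin n → Fin 3) (i : Fin n) (w k : Fin 3) :
    (shearElement K v i : Matrix (Fin 3) (Fin 3) K) w k =
      if w = k ∨ (k = v i ∧ k < w) then 1 else 0 := rfl

lemma shearElement_mem (v : Fin n → Fin 3) (i : Fin n) :
    shearElement K v i ∈ lowerTriangular K := by
  intro w k hwk
  rw [coe_shearElement, if_neg]
  rintro (h | h)
  · exact hwk.ne h
  · exact lt_asymm hwk h.2

/-- Setting all variables but the `v i`-th of each block to zero. -/
noncomputable def restrictTo (K : Type*) [Field K] (v : Fin n → Fin 3) : Poly n K →ₐ[K] Poly n K :=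
  aeval fun p => if p.2 = v p.1 then X p else 0

lemma IsMonomialIdeal.restrictTo_mem {I : Ideal (Poly n K)} (hI : IsMonomialIdeal I)
    (v : Fin n → Fin 3) {f : Poly n K} (hf : f ∈ I) : restrictTo K v f ∈ I := by
  rw [f.as_sum, map_sum]
  refine I.sum_mem fun d hd => ?_
  have hmem := hI f hf d (mem_support_iff.1 hd)
  rw [restrictTo, aeval_monomial]
  refine I.mul_mem_left _ ?_
  by_cases h : ∀ p ∈ d.support, p.2 = v p.1
  · have : (d.prod fun p k => (if p.2 = v p.1 then X p else 0 : Poly n K) ^ k) = monomial d 1 := by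
      rw [monomial_eq, C_1, one_mul]
      exact prod_congr rfl fun p hp => by simp only [if_pos (h p hp)]
    rw [this]
    exact hmem
  · push Not at h
    obtain ⟨p, hp, hpv⟩ := h
    have : (d.prod fun p k => (if p.2 = v p.1 then X p else 0 : Poly n K) ^ k) = 0 := by
      refine prod_eq_zero hp ?_
      simp only [if_neg hpv, zero_pow (Finsupp.mem_support_iff.1 hp)]
    rw [this]
    exact I.zero_mem

/-- A Borel-fixed monomial ideal allows moving, in every block, a monomial to the power of a
variable which comes no later than the variables of the monomial. -/
lemma IsBorelFixed.single_mem_exponents {I : Ideal (Poly n K)} (hI : IsBorelFixed I)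
    (hmon : IsMonomialIdeal I) {e : Fin n → Fin 3 → ℕ} (he : e ∈ exponents I)
    (v : Fin n → Fin 3) (hv : ∀ i w, e i w ≠ 0 → v i ≤ w) :
    (fun i => Pi.single (v i) (∑ w, e i w)) ∈ exponents I := by
  -- After the shear, every variable no earlier than `v i` involves the `v i`-th variable with
  -- coefficient 1. Discarding the other variables, which a monomial ideal permits, leaves the
  -- required pure powers.
  have h := hmon.restrictTo_mem v (hI.substitution_mem (shearElement_mem v) he)
  have hX : ∀ i w, v i ≤ w →
      restrictTo K v (substitution (shearElement K v) (X (i, w))) = X (i, v i) := by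
    intro i w hw
    rw [substitution_X, map_sum, sum_eq_single (v i)]
    · simp only [map_mul, restrictTo, aeval_X, coe_shearElement, ↓reduceIte]
      rw [if_pos]
      · simp
      · rcases hw.eq_or_lt with h | h
        · exact Or.inl h.symm
        · exact Or.inr ⟨trivial, h⟩
    · intro k _ hk
      simp [restrictTo, hk]
    · simp
  have heq : restrictTo K v (substitution (shearElement K v) (monomialOf K e)) =
      monomialOf K fun i => Pi.single (v i) (∑ w, e i w) := by
    rw [monomialOf_eq_prod, monomialOf_eq_prod]
    simp only [map_prod, map_pow]
    refine prod_congr rfl fun i _ => ?_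
    have h1 : ∀ w, restrictTo K v (substitution (shearElement K v) (X (i, w))) ^ e i w =
        X (i, v i) ^ e i w := by
      intro w
      by_cases hw : e i w = 0
      · simp [hw]
      · rw [hX i w (hv i w hw)]
    simp_rw [h1]
    rw [prod_pow_eq_pow_sum, prod_eq_single (v i)]
    · simp
    · intro k _ hk
      simp [hk]
    · simp
  rw [exponents, Set.mem_ofPred_eq, ← heq]
  exact h

end Borel

/-! ### The ideal $M_n$: its monomials, Hilbert function and Borel invariance -/

section GenericInitialIdeal

lemma single_add_le_iff {α : Type*} {p : α} {s d : α →₀ ℕ} (hp : s p = 0) :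
    Finsupp.single p 1 + s ≤ d ↔ 0 < d p ∧ s ≤ d := by
  classical
  simp only [Finsupp.le_def, Finsupp.add_apply]
  constructor
  · intro h
    refine ⟨?_, fun q => le_trans (Nat.le_add_left _ _) (h q)⟩
    have := h p
    rw [Finsupp.single_eq_same] at this
    omega
  · rintro ⟨h1, h2⟩ q
    by_cases hq : q = p
    · subst hq
      rw [Finsupp.single_eq_same, hp]
      exact h1
    · rw [Finsupp.single_eq_of_ne hq, zero_add]
      exact h2 q

lemma single_le_iff_pos {α : Type*} {p : α} {d : α →₀ ℕ} :
    Finsupp.single p 1 ≤ d ↔ 0 < d p := by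
  rw [Finsupp.single_le_iff, Nat.one_le_iff_ne_zero, pos_iff_ne_zero]

/-- The exponents of the generators of `M_n`. -/
def generatorExponents (n : ℕ) : Set (Fin n × Fin 3 →₀ ℕ) :=
  {d | ∃ i j, i ≠ j ∧ d = .single (i, 0) 1 + .single (j, 0) 1} ∪
  {d | ∃ i j k, i ≠ j ∧ i ≠ k ∧ j ≠ k ∧
    d = .single (i, 0) 1 + (.single (j, 1) 1 + .single (k, 1) 1)} ∪
  {d | ∃ i j k l, i ≠ j ∧ i ≠ k ∧ i ≠ l ∧ j ≠ k ∧ j ≠ l ∧ k ≠ l ∧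
    d = .single (i, 1) 1 + (.single (j, 1) 1 + (.single (k, 1) 1 + .single (l, 1) 1))}

lemma genericInitialIdeal_eq_span :
    genericInitialIdeal n K =
      Ideal.span ((fun d => monomial d (1 : K)) '' generatorExponents n) := by
  rw [genericInitialIdeal, generatorExponents, Set.image_union, Set.image_union]
  congr 3
  · ext f
    simp only [Set.mem_ofPred_eq, Set.mem_image]
    constructor
    · rintro ⟨i, j, hij, rfl⟩
      exact ⟨_, ⟨i, j, hij, rfl⟩, by simp [x, X, monomial_mul]⟩
    · rintro ⟨_, ⟨i, j, hij, rfl⟩, rfl⟩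
      exact ⟨i, j, hij, by simp [x, X, monomial_mul]⟩
  · ext f
    simp only [Set.mem_ofPred_eq, Set.mem_image]
    constructor
    · rintro ⟨i, j, k, hij, hik, hjk, rfl⟩
      exact ⟨_, ⟨i, j, k, hij, hik, hjk, rfl⟩, by simp [x, y, X, monomial_mul, add_assoc]⟩
    · rintro ⟨_, ⟨i, j, k, hij, hik, hjk, rfl⟩, rfl⟩
      exact ⟨i, j, k, hij, hik, hjk, by simp [x, y, X, monomial_mul, add_assoc]⟩
  · ext f
    simp only [Set.mem_ofPred_eq]
    constructor
    · rintro ⟨i, j, k, l, hij, hik, hil, hjk, hjl, hkl, rfl⟩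
      exact ⟨_, ⟨i, j, k, l, hij, hik, hil, hjk, hjl, hkl, rfl⟩,
        by simp [y, X, monomial_mul, add_assoc]⟩
    · rintro ⟨_, ⟨i, j, k, l, hij, hik, hil, hjk, hjl, hkl, rfl⟩, rfl⟩
      exact ⟨i, j, k, l, hij, hik, hil, hjk, hjl, hkl, by simp [y, X, monomial_mul, add_assoc]⟩

lemma exists_generatorExponents_le_iff (d : Fin n × Fin 3 →₀ ℕ) :
    (∃ s ∈ generatorExponents n, s ≤ d) ↔ (exponentEquiv n).symm d ∈ genericExponents n := by
  have h1 : ∀ i j : Fin n, i ≠ j →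
      ((.single (i, 0) 1 + .single (j, 0) 1 : Fin n × Fin 3 →₀ ℕ) ≤ d ↔
        0 < d (i, 0) ∧ 0 < d (j, 0)) := by
    intro i j hij
    rw [single_add_le_iff (by simp [hij]), single_le_iff_pos]
  have h2 : ∀ i j k : Fin n, i ≠ j → i ≠ k → j ≠ k →
      ((.single (i, 0) 1 + (.single (j, 1) 1 + .single (k, 1) 1) : Fin n × Fin 3 →₀ ℕ) ≤ d ↔
        0 < d (i, 0) ∧ 0 < d (j, 1) ∧ 0 < d (k, 1)) := by
    intro i j k hij hik hjk
    rw [single_add_le_iff (by simp), single_add_le_iff (by simp [hjk]), single_le_iff_pos]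
  have h3 : ∀ i j k l : Fin n, i ≠ j → i ≠ k → i ≠ l → j ≠ k → j ≠ l → k ≠ l →
      ((.single (i, 1) 1 + (.single (j, 1) 1 + (.single (k, 1) 1 + .single (l, 1) 1)) :
        Fin n × Fin 3 →₀ ℕ) ≤ d ↔
        0 < d (i, 1) ∧ 0 < d (j, 1) ∧ 0 < d (k, 1) ∧ 0 < d (l, 1)) := by
    intro i j k l hij hik hil hjk hjl hkl
    rw [single_add_le_iff (by simp [hij, hik, hil]), single_add_le_iff (by simp [hjk, hjl]),
      single_add_le_iff (by simp [hkl]), single_le_iff_pos]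
  simp only [generatorExponents, genericExponents, Set.mem_union, Set.mem_ofPred_eq,
    exponentEquiv_symm_apply]
  constructor
  · rintro ⟨_, (⟨i, j, hij, rfl⟩ | ⟨i, j, k, hij, hik, hjk, rfl⟩) |
      ⟨i, j, k, l, hij, hik, hil, hjk, hjl, hkl, rfl⟩, hle⟩
    · exact Or.inl ⟨i, j, hij, (h1 i j hij).1 hle⟩
    · exact Or.inr (Or.inl ⟨i, j, k, hij, hik, hjk, (h2 i j k hij hik hjk).1 hle⟩)
    · exact Or.inr (Or.inr ⟨i, j, k, l, hij, hik, hil, hjk, hjl, hkl,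
        (h3 i j k l hij hik hil hjk hjl hkl).1 hle⟩)
  · rintro (⟨i, j, hij, h⟩ | ⟨i, j, k, hij, hik, hjk, h⟩ |
      ⟨i, j, k, l, hij, hik, hil, hjk, hjl, hkl, h⟩)
    · exact ⟨_, Or.inl (Or.inl ⟨i, j, hij, rfl⟩), (h1 i j hij).2 h⟩
    · exact ⟨_, Or.inl (Or.inr ⟨i, j, k, hij, hik, hjk, rfl⟩), (h2 i j k hij hik hjk).2 h⟩
    · exact ⟨_, Or.inr ⟨i, j, k, l, hij, hik, hil, hjk, hjl, hkl, rfl⟩,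
        (h3 i j k l hij hik hil hjk hjl hkl).2 h⟩

lemma mem_genericInitialIdeal_iff {f : Poly n K} :
    f ∈ genericInitialIdeal n K ↔
      ∀ d, f.coeff d ≠ 0 → (exponentEquiv n).symm d ∈ genericExponents n := by
  rw [genericInitialIdeal_eq_span, mem_ideal_span_monomial_image]
  simp_rw [exists_generatorExponents_le_iff, mem_support_iff]

lemma exponents_genericInitialIdeal :
    exponents (genericInitialIdeal n K) = genericExponents n := by
  classical
  ext e
  rw [exponents, Set.mem_ofPred_eq, mem_genericInitialIdeal_iff]
  constructor
  · intro h
    simpa using h (exponentEquiv n e) (by simp [monomialOf])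
  · intro h d hd
    rw [monomialOf, coeff_monomial, ne_eq, ite_eq_right_iff, Classical.not_imp] at hd
    rw [← hd.1, Equiv.symm_apply_apply]
    exact h

lemma isMonomialIdeal_genericInitialIdeal : IsMonomialIdeal (genericInitialIdeal n K) := by
  intro f hf d hd
  rw [← mem_exponents_symm, exponents_genericInitialIdeal]
  exact mem_genericInitialIdeal_iff.1 hf d hd

lemma hasMultiviewHilbertFunction_genericInitialIdeal (hn : 2 ≤ n) :
    HasMultiviewHilbertFunction (genericInitialIdeal n K) := by
  refine ⟨isMonomialIdeal_genericInitialIdeal.isMultihomogeneous, fun u => ?_⟩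
  rw [isMonomialIdeal_genericInitialIdeal.hilbertFunction_eq, exponents_genericInitialIdeal]
  exact card_notMem_genericExponents hn u

lemma x_mul_x_mem {i j : Fin n} (h : i ≠ j) : (x i * x j : Poly n K) ∈ genericInitialIdeal n K :=
  Ideal.subset_span (Or.inl (Or.inl ⟨i, j, h, rfl⟩))

lemma x_mul_y_mul_y_mem {i j k : Fin n} (hij : i ≠ j) (hik : i ≠ k) (hjk : j ≠ k) :
    (x i * y j * y k : Poly n K) ∈ genericInitialIdeal n K :=
  Ideal.subset_span (Or.inl (Or.inr ⟨i, j, k, hij, hik, hjk, rfl⟩))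

lemma substitution_x {g : Fin n → GL (Fin 3) K} (hg : ∀ i, g i ∈ lowerTriangular K) (i : Fin n) :
    ∃ a : Poly n K, substitution g (x i) = a * x i := by
  refine ⟨C ((g i : Matrix (Fin 3) (Fin 3) K) 0 0), ?_⟩
  have h1 := hg i 0 1 (by decide)
  have h2 := hg i 0 2 (by decide)
  rw [x, substitution_X, Fin.sum_univ_three]
  simp [h1, h2]

lemma substitution_y {g : Fin n → GL (Fin 3) K} (hg : ∀ i, g i ∈ lowerTriangular K) (i : Fin n) :
    ∃ b c : Poly n K, substitution g (y i) = b * x i + c * y i := by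
  refine ⟨C ((g i : Matrix (Fin 3) (Fin 3) K) 1 0), C ((g i : Matrix (Fin 3) (Fin 3) K) 1 1), ?_⟩
  have h2 := hg i 1 2 (by decide)
  rw [y, substitution_X, Fin.sum_univ_three]
  simp [h2, x]

/-- A lower triangular substitution scales $x$ and sends $y$ to a combination of $x$ and $y$. In the
expanded image of a generator, each term contains two $x$'s, or one $x$ and two $y$'s, or four
$y$'s, always from distinct blocks. -/
lemma map_substitution_genericInitialIdeal_le {g : Fin n → GL (Fin 3) K}
    (hg : ∀ i, g i ∈ lowerTriangular K) :
    (genericInitialIdeal n K).map (substitution g) ≤ genericInitialIdeal n K := by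
  conv_lhs => rw [genericInitialIdeal]
  rw [Ideal.map_span, Ideal.span_le]
  have hxx : ∀ {i j : Fin n} (_ : i ≠ j) (a : Poly n K),
      a * (x i * x j) ∈ genericInitialIdeal n K := fun h a =>
    Ideal.mul_mem_left _ a (x_mul_x_mem h)
  have hxyy : ∀ {i j k : Fin n} (_ : i ≠ j) (_ : i ≠ k) (_ : j ≠ k) (a : Poly n K),
      a * (x i * y j * y k) ∈ genericInitialIdeal n K := fun h h' h'' a =>
    Ideal.mul_mem_left _ a (x_mul_y_mul_y_mem h h' h'')
  rintro _ ⟨_, (⟨i, j, hij, rfl⟩ | ⟨i, j, k, hij, hik, hjk, rfl⟩) |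
    ⟨i, j, k, l, hij, hik, hil, hjk, hjl, hkl, rfl⟩, rfl⟩
  · obtain ⟨a, ha⟩ := substitution_x hg i
    obtain ⟨a', ha'⟩ := substitution_x hg j
    rw [SetLike.mem_coe, map_mul, ha, ha']
    convert hxx hij (a * a') using 1
    ring
  · obtain ⟨a, ha⟩ := substitution_x hg i
    obtain ⟨b, c, hj⟩ := substitution_y hg j
    obtain ⟨b', c', hk⟩ := substitution_y hg k
    rw [SetLike.mem_coe, map_mul, map_mul, ha, hj, hk]
    convert add_mem (add_mem (hxx hij (a * b * (b' * x k + c' * y k)))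
      (hxx hik (a * b' * c * y j))) (hxyy hij hik hjk (a * c * c')) using 1
    ring
  · obtain ⟨b₁, c₁, h₁⟩ := substitution_y hg i
    obtain ⟨b₂, c₂, h₂⟩ := substitution_y hg j
    obtain ⟨b₃, c₃, h₃⟩ := substitution_y hg k
    obtain ⟨b₄, c₄, h₄⟩ := substitution_y hg l
    have hyyyy : (y i * y j * y k * y l : Poly n K) ∈ genericInitialIdeal n K :=
      Ideal.subset_span (Or.inr ⟨i, j, k, l, hij, hik, hil, hjk, hjl, hkl, rfl⟩)
    rw [SetLike.mem_coe, map_mul, map_mul, map_mul, h₁, h₂, h₃, h₄]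
    set r₃ : Poly n K := b₃ * x k + c₃ * y k with hr₃
    set r₄ : Poly n K := b₄ * x l + c₄ * y l with hr₄
    -- The first two factors are expanded into $xx$, $xy$, $yx$ and $yy$; `hA` to `hD` treat these
    -- four terms, expanding `r₃` and `r₄` only as far as needed.
    have hA := hxx hij (b₁ * b₂ * r₃ * r₄)
    have hB : b₁ * c₂ * (x i * y j) * (r₃ * r₄) ∈ genericInitialIdeal n K := by
      convert add_mem (hxx hik (b₁ * c₂ * y j * b₃ * r₄))
        (add_mem (hxx hil (b₁ * c₂ * y j * c₃ * y k * b₄))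
          (hxyy hij hik hjk (b₁ * c₂ * c₃ * c₄ * y l))) using 1
      rw [hr₃, hr₄]
      ring
    have hC : b₂ * c₁ * (x j * y i) * (r₃ * r₄) ∈ genericInitialIdeal n K := by
      convert add_mem (hxx hjk (b₂ * c₁ * y i * b₃ * r₄))
        (add_mem (hxx hjl (b₂ * c₁ * y i * c₃ * y k * b₄))
          (hxyy hij.symm hjk hik (b₂ * c₁ * c₃ * c₄ * y l))) using 1
      rw [hr₃, hr₄]
      ring
    have hD : c₁ * c₂ * (y i * y j) * (r₃ * r₄) ∈ genericInitialIdeal n K := by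
      convert add_mem (add_mem (hxyy hik.symm hjk.symm hij (c₁ * c₂ * b₃ * r₄))
        (hxyy hil.symm hjl.symm hij (c₁ * c₂ * c₃ * y k * b₄)))
        (Ideal.mul_mem_left _ (c₁ * c₂ * c₃ * c₄) hyyyy) using 1
      rw [hr₃, hr₄]
      ring
    convert add_mem (add_mem hA hB) (add_mem hC hD) using 1
    ring

/-- The order of multiplication reverses because the outer substitution acts on the variables in the
image of the inner one. -/
lemma substitution_comp (g h : Fin n → GL (Fin 3) K) :
    (substitution g).comp (substitution h) = substitution (h * g) := by
  refine algHom_ext fun p => ?_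
  rw [AlgHom.comp_apply, substitution_X, substitution_X, map_sum]
  simp_rw [map_mul, substitution_X, ← algebraMap_eq, AlgHom.commutes, algebraMap_eq, mul_sum]
  rw [sum_comm]
  refine sum_congr rfl fun k _ => ?_
  rw [Pi.mul_apply, Units.val_mul, Matrix.mul_apply, map_sum, sum_mul]
  refine sum_congr rfl fun w _ => ?_
  rw [C_mul, mul_assoc]

lemma substitution_one : substitution (1 : Fin n → GL (Fin 3) K) = AlgHom.id K _ := by
  refine algHom_ext fun p => ?_
  rw [substitution_X, sum_eq_single p.2]
  · simp
  · intro k _ hk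
    simp [Matrix.one_apply_ne hk.symm]
  · simp

/-- Representatives of one class differ by a scalar matrix, which is itself lower triangular. This
is needed because invariance is required for every choice of representatives. -/
lemma mem_lowerTriangular_of_mk_mem_borel {g : GL (Fin 3) K}
    (h : Matrix.ProjGenLinGroup.mk g ∈ borel K) : g ∈ lowerTriangular K := by
  obtain ⟨b, hb, hbg⟩ := h
  obtain ⟨u, rfl⟩ := Matrix.ProjGenLinGroup.mk_eq_mk_iff.1 hbg
  refine mul_mem hb fun i j hij => ?_
  simp [Matrix.GeneralLinearGroup.scalar, hij.ne]

lemma isBorelFixed_genericInitialIdeal : IsBorelFixed (genericInitialIdeal n K) := by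
  intro b hb g hgb
  have hg : ∀ i, g i ∈ lowerTriangular K := fun i =>
    mem_lowerTriangular_of_mk_mem_borel (by rw [hgb]; exact hb i)
  refine le_antisymm (map_substitution_genericInitialIdeal_le hg) fun f hf => ?_
  have hinv : substitution g⁻¹ f ∈ genericInitialIdeal n K :=
    map_substitution_genericInitialIdeal_le (fun i => inv_mem (hg i)) (Ideal.mem_map_of_mem _ hf)
  have h := Ideal.mem_map_of_mem (substitution g) hinv
  rwa [← AlgHom.comp_apply, substitution_comp, inv_mul_cancel, substitution_one] at h

end GenericInitialIdeal

/-! ### Uniqueness -/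

section Uniqueness

/-- Only `k` of the three positions can lie beyond `2 - k`, so a set with more than `k` elements
meets the others. -/
lemma exists_le_two_sub_of_lt_card {A : Finset (Fin 3)} {k : ℕ} (h : k < #A) :
    ∃ v ∈ A, (v : ℕ) + k ≤ 2 := by
  by_contra! hA
  have hsub : A.image (fun v : Fin 3 => 2 - (v : ℕ)) ⊆ range k := by
    intro m hm
    obtain ⟨v, hv, rfl⟩ := mem_image.1 hm
    have := hA v hv
    have := v.isLt
    rw [mem_range]
    omega
  have hc := card_le_card hsub
  rw [card_image_of_injective, card_range] at hc
  · omega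
  · intro v w hvw
    have := v.isLt
    have := w.isLt
    simp only at hvw
    exact Fin.ext (by omega)

/-- An occurring variable `w` forces level at least `2 - w`, so `v ≤ 2 - level e ≤ w`. -/
lemma le_of_add_level_le_two {e : Fin 3 → ℕ} {v w : Fin 3} (h : (v : ℕ) + level e ≤ 2)
    (hw : e w ≠ 0) : v ≤ w := by
  rw [Fin.le_def]
  have hw' := Nat.pos_of_ne_zero hw
  fin_cases w
  · have := two_le_level hw'
    simp; omega
  · have := one_le_level hw'
    simp; omega
  · simp; omega

/-- A Borel-fixed ideal with the multiview Hilbert function contains no monomial outside `M_n`. -/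
lemma exponents_subset_genericExponents [Infinite K] (hn : 2 ≤ n) {I : Ideal (Poly n K)}
    (hB : IsBorelFixed I) (hH : HasMultiviewHilbertFunction I) :
    exponents I ⊆ genericExponents n := by
  classical
  intro e he
  by_contra hne
  have hmon := hB.isMonomialIdeal
  obtain ⟨a, b, c, habc, hlevel⟩ := exists_tripleCount_of_notMem hn hne
  obtain ⟨N₀, hN₀⟩ : ∃ N₀ : ℕ, ∀ N, N₀ ≤ N → ∀ e, e ∈ exponents I →
      (fun i v => min (e i v) N) ∈ exponents I := by
    obtain ⟨N₀, h⟩ := exists_truncation_bound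
      (S := {f : Fin n × Fin 3 → ℕ | Function.curry f ∈ exponents I})
      fun f f' hff' hf => isUpperSet_exponents I (fun i v => hff' (i, v)) hf
    exact ⟨N₀, fun N hN e he => h N hN (Function.uncurry e) he⟩
  -- `N` must also bound the total degree of `e`, so that the powers obtained from `e` divide a
  -- monomial with exponent `N` at the chosen variables.
  set N := max N₀ (∑ i, ∑ v, e i v) with hN
  have htrunc : ∀ e, e ∈ exponents I ↔ (fun i v => min (e i v) N) ∈ exponents I := fun e =>
    ⟨hN₀ N (le_max_left _ _) e,
      fun h => isUpperSet_exponents I (fun i v => min_le_left _ _) h⟩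
  obtain ⟨t, htI, ht⟩ := exists_notMem_of_card_eq htrunc
    (fun u => by rw [← hmon.hilbertFunction_eq u, hH.2 u, multiviewCount]) habc
  choose v hv hvl using fun l => exists_le_two_sub_of_lt_card (ht l)
  -- Since the level of `e` in block `i` is at most the multiplicity of `i` in the triple, `v i`
  -- comes no later than any variable of `e` there, and the Borel move applies.
  refine htI (isUpperSet_exponents I ?_ (hB.single_mem_exponents hmon he v fun i w hw =>
    le_of_add_level_le_two ((Nat.add_le_add_left (hlevel i) _).trans (hvl i)) hw))
  intro i w
  by_cases hw : w = v i
  · subst hw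
    simp only [Pi.single_eq_same, (mem_filter.1 (hv i)).2]
    exact (single_le_sum (f := fun i => ∑ v, e i v) (fun _ _ => Nat.zero_le _)
      (mem_univ i)).trans (le_max_right _ _)
  · simp [hw]

theorem eq_genericInitialIdeal [Infinite K] (hn : 2 ≤ n) {I : Ideal (Poly n K)}
    (hB : IsBorelFixed I) (hH : HasMultiviewHilbertFunction I) :
    I = genericInitialIdeal n K := by
  classical
  have hmon := hB.isMonomialIdeal
  have hsub := exponents_subset_genericExponents hn hB hH
  refine hmon.ext isMonomialIdeal_genericInitialIdeal ?_
  rw [exponents_genericInitialIdeal]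
  refine hsub.antisymm fun e he => ?_
  set u : Fin n → ℕ := fun i => ∑ v, e i v
  have hcard : (#{e ∈ exponentsOfDegree u | e ∉ exponents I} : ℤ) =
      #{e ∈ exponentsOfDegree u | e ∉ genericExponents n} := by
    rw [← hmon.hilbertFunction_eq u, hH.2 u, card_notMem_genericExponents hn, multiviewCount]
  have hle : {e ∈ exponentsOfDegree u | e ∉ genericExponents n} ⊆
      {e ∈ exponentsOfDegree u | e ∉ exponents I} :=
    monotone_filter_right _ fun e _ h h' => h (hsub h')
  -- In each degree the standard monomials of $M_n$ are among those of `I` and equally numerous, so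
  -- the two sets coincide.
  have heq := eq_of_subset_of_card_le hle (by exact_mod_cast hcard.le)
  by_contra hne
  have : e ∈ (exponentsOfDegree u).filter (· ∉ exponents I) :=
    mem_filter.2 ⟨mem_exponentsOfDegree.2 fun _ => rfl, hne⟩
  rw [← heq] at this
  exact (mem_filter.1 this).2 he

end Uniqueness

end Multiview

theorem proposition3p6 (K : Type*) [Field K] [IsAlgClosed K] (n : ℕ) (hn : 2 ≤ n) :
    (Multiview.IsBorelFixed (Multiview.genericInitialIdeal n K) ∧
      Multiview.HasMultiviewHilbertFunction (Multiview.genericInitialIdeal n K)) ∧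
    ∀ I : Ideal (Multiview.Poly n K),
      Multiview.IsBorelFixed I → Multiview.HasMultiviewHilbertFunction I →
        I = Multiview.genericInitialIdeal n K := by
  have : Infinite K := IsAlgClosed.instInfinite
  exact ⟨⟨Multiview.isBorelFixed_genericInitialIdeal,
    Multiview.hasMultiviewHilbertFunction_genericInitialIdeal hn⟩,
    fun _ hB hH => Multiview.eq_genericInitialIdeal hn hB hH⟩
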